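/- Let $N\ge 1$ be an integer and $a_1,b_1\ge 0$. For $\theta>0$ and real $a,z$ let $$\mathbb{B}(a;z;\theta,N)=\sum_{k=0}^{\infty}\frac{\Gamma(\theta N)}{\Gamma(\theta N+k)\,k!}\Big(\frac{az}{2}\Big)^{2k}$$ be the one-variable ($M=1$) type BC Bessel function; equivalently $\mathbb{B}(a;iz;\theta,N)=\Gamma(\theta N)(az/2)^{-(\theta N-1)}J_{\theta N-1}(az)$ with $J_\alpha$ the Bessel function of the first kind. A random variable $c_1\ge 0$ is written $c_1=a_1\boxplus^{\theta}_{1,N}b_1$ if $$\mathbb{E}\big[\mathbb{B}(c_1;z;\theta,N)\big]=\mathbb{B}(a_1;z;\theta,N)\,\mathbb{B}(b_1;z;\theta,N)\qquad\text{for all } z\in\mathbb{R}.$$ **Theorem 3.4.** For every $\theta$ with $\theta N\ge \tfrac12$ (in particular for all large $\theta$) there is exactly one probability measure on $[0,\infty)$ that is the law of such a $c_1$. If $c_1=c_1(\theta)=a_1\boxplus^{\theta}_{1,N}b_1$ for all large $\theta$, then, as $\theta\to\infty$, $$\sqrt{\theta}\,\big(c_1^2-a_1^2-b_1^2\big)\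 \xrightarrow{\ d\ }\ \mathcal{N}\Big(0,\tfrac{2}{N}a_1^2b_1^2\Big),$$ where $\mathcal N(0,0)$ is the point mass at $0$. -/

import Mathlib

open MeasureTheory ProbabilityTheory Filter Topology

/-- The type BC Bessel function `𝔹(a; z; θ, N)` of one variable (that is, for `M = 1`),
`∑ₖ Γ(θN) / (Γ(θN + k) k!) (a z / 2)^(2k)`. This is the usual modified Bessel function of index
`α = θN - 1`, normalized to be `1` at `z = 0`; equivalently,
`𝔹(a; i z; θ, N) = Γ(θN) (a z / 2)^(-α) J_α(a z)`. The series converges for all real `a`, `z`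
as soon as `θN > 0`. -/
noncomputable def besselBC (N : ℕ) (θ a z : ℝ) : ℝ :=
  ∑' k : ℕ, Real.Gamma (θ * N) / (Real.Gamma (θ * N + k) * (k.factorial : ℝ)) *
    (a * z / 2) ^ (2 * k)

/-- `μ` is the law of the rectangular sum `a ⊞^θ_{1,N} b`: it is a probability measure carried by
`[0, ∞)` such that, for `c` distributed as `μ`,
`E[𝔹(c; z; θ, N)] = 𝔹(a; z; θ, N) 𝔹(b; z; θ, N)` for all real `z`. -/
structure IsRectSumLaw (N : ℕ) (θ a b : ℝ) (μ : Measure ℝ) : Prop where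
  isProbabilityMeasure : IsProbabilityMeasure μ
  nonneg : ∀ᵐ c ∂μ, 0 ≤ c
  integrable : ∀ z : ℝ, Integrable (fun c => besselBC N θ c z) μ
  integral_eq : ∀ z : ℝ, ∫ c, besselBC N θ c z ∂μ = besselBC N θ a z * besselBC N θ b z

/-- The random variable `c` on `(Ω, P)` is a rectangular sum `a ⊞^θ_{1,N} b`. -/
def IsRectSum {Ω : Type*} [MeasurableSpace Ω] (N : ℕ) (θ a b : ℝ) (c : Ω → ℝ)
    (P : Measure Ω) : Prop :=
  AEMeasurable c P ∧ IsRectSumLaw N θ a b (P.map c)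

/-! Write s = θN. The Bessel series obeys Gegenbauer's product formula 𝔹(a)𝔹(b) = E 𝔹(√(a² + b² +
2abX)), where X on [-1, 1] has density proportional to (1 - x²)^(s - 3/2), or is a fair sign if s =
1/2. So the third side of a random triangle is a rectangular sum (`isRectSumLaw_cosineLaw`). The
formula is checked on coefficients: 𝔹(c; z) is a power series in z²c², so E 𝔹(c; z) generates the
moments of c², and matching them comes down to Chu–Vandermonde
(`sum_antidiagonal_pow_div_risingFactorial`).

Conversely, the transform fixes the moments of c²; their growth forces c ≤ a + b, and a bounded law
is determined by its moments (`IsRectSumLaw.eq_cosineLaw`). Hence c² - a² - b² has exactly the law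
of 2abX, and only √θ X matters in the limit. Its characteristic function is a Bessel series
converging termwise, under a summable bound, to that of N(0, 1/(2N))
(`tendsto_charFun_of_isGegenbauerLaw`); the factor 2ab turns the variance into 2a²b²/N. -/

/-- The rising factorial `s (s + 1) ⋯ (s + n - 1)`. -/
noncomputable def risingFactorial (s : ℝ) (n : ℕ) : ℝ := (ascPochhammer ℝ n).eval s

/-! ### Rising factorials and the coefficients of a product of Bessel series -/

section RisingFactorial

variable {s : ℝ}

@[simp]
theorem risingFactorial_zero (s : ℝ) : risingFactorial s 0 = 1 := by simp [risingFactorial]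

theorem risingFactorial_succ (s : ℝ) (n : ℕ) :
    risingFactorial s (n + 1) = risingFactorial s n * (s + n) :=
  ascPochhammer_succ_eval n s

theorem risingFactorial_succ_left (s : ℝ) (n : ℕ) :
    risingFactorial s (n + 1) = s * risingFactorial (s + 1) n := by
  simp [risingFactorial, ascPochhammer_succ_left]

theorem risingFactorial_pos (hs : 0 < s) (n : ℕ) : 0 < risingFactorial s n :=
  ascPochhammer_pos n s hs

theorem Gamma_add_natCast_eq_risingFactorial_mul (hs : 0 < s) (n : ℕ) :
    Real.Gamma (s + n) = risingFactorial s n * Real.Gamma s := by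
  induction n with
  | zero => simp
  | succ n ih =>
    have h : s + n ≠ 0 := by positivity
    rw [Nat.cast_succ, ← add_assoc, Real.Gamma_add_one h, ih, risingFactorial_succ]
    ring

theorem pow_le_risingFactorial (hs : 0 < s) (n : ℕ) : s ^ n ≤ risingFactorial s n := by
  induction n with
  | zero => simp
  | succ n ih =>
    rw [pow_succ, risingFactorial_succ]
    gcongr
    · exact (risingFactorial_pos hs n).le
    · simp

theorem risingFactorial_half (m : ℕ) :
    risingFactorial (1 / 2) m = (2 * m).factorial / (4 ^ m * m.factorial) := by
  induction m with
  | zero => simp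
  | succ m ih =>
    rw [risingFactorial_succ, ih, show 2 * (m + 1) = 2 * m + 1 + 1 by ring, Nat.factorial_succ,
      Nat.factorial_succ, Nat.factorial_succ]
    push_cast
    field_simp
    ring

/-- The **Chu–Vandermonde identity** for rising factorials. -/
theorem sum_choose_mul_descFactorial_div_risingFactorial (hs : 0 < s) (i j : ℕ) :
    ∑ m ∈ Finset.range (i + 1), (i.choose m : ℝ) * j.descFactorial m / risingFactorial s m =
      risingFactorial s (i + j) / (risingFactorial s i * risingFactorial s j) := by
  induction i generalizing j s with
  | zero => simp [(risingFactorial_pos hs j).ne']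
  | succ i ih =>
    -- Pascal's rule: the second sum is, after a shift, the same sum for s + 1 and j - 1, hence the
    -- induction over all s and j.
    have hsplit : ∑ m ∈ Finset.range (i + 2),
          ((i + 1).choose m : ℝ) * j.descFactorial m / risingFactorial s m =
        ∑ m ∈ Finset.range (i + 1), (i.choose m : ℝ) * j.descFactorial m / risingFactorial s m +
        ∑ m ∈ Finset.range (i + 1),
          (i.choose m : ℝ) * j.descFactorial (m + 1) / risingFactorial s (m + 1) := by
      have h := Finset.sum_range_succ
        (fun m => (i.choose m : ℝ) * j.descFactorial m / risingFactorial s m) (i + 1)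
      rw [Nat.choose_succ_self] at h
      simp only [Nat.cast_zero, zero_mul, zero_div, add_zero] at h
      rw [← h, Finset.sum_range_succ', Finset.sum_range_succ' _ (i + 1), add_right_comm,
        ← Finset.sum_add_distrib]
      congr 1
      · refine Finset.sum_congr rfl fun m _ => ?_
        rw [Nat.choose_succ_succ]
        push_cast
        ring
      · simp
    rw [hsplit, ih hs]
    have p1 := (risingFactorial_pos hs i).ne'
    have hs' : s + i ≠ 0 := by positivity
    cases j with
    | zero =>
      have p3 := (risingFactorial_pos hs (i + 1)).ne'
      simp [p1, p3]
    | succ j =>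
      have h2 : ∑ m ∈ Finset.range (i + 1),
          (i.choose m : ℝ) * (j + 1).descFactorial (m + 1) / risingFactorial s (m + 1) =
          (j + 1) / s * ∑ m ∈ Finset.range (i + 1),
            (i.choose m : ℝ) * j.descFactorial m / risingFactorial (s + 1) m := by
        rw [Finset.mul_sum]
        refine Finset.sum_congr rfl fun m _ => ?_
        rw [Nat.succ_descFactorial_succ, risingFactorial_succ_left]
        push_cast
        have := (risingFactorial_pos (by linarith : 0 < s + 1) m).ne'
        field_simp
      rw [h2, ih (by linarith)]
      have e1 : risingFactorial (s + 1) (i + j) = risingFactorial s (i + j + 1) / s := by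
        rw [risingFactorial_succ_left]; field_simp
      have e2 : risingFactorial (s + 1) i = risingFactorial s i * (s + i) / s := by
        rw [← risingFactorial_succ, risingFactorial_succ_left]; field_simp
      have e3 : risingFactorial (s + 1) j = risingFactorial s (j + 1) / s := by
        rw [risingFactorial_succ_left]; field_simp
      have p2 := (risingFactorial_pos hs (j + 1)).ne'
      rw [e1, e2, e3, show i + 1 + (j + 1) = i + j + 1 + 1 by ring,
        show i + (j + 1) = i + j + 1 by ring, risingFactorial_succ s (i + j + 1),
        risingFactorial_succ s i]
      push_cast
      field_simp
      ring

/-- Chu–Vandermonde in a form symmetric in i and j. The range depends on k only, so that this sum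
can be exchanged with one over i + j = k. -/
theorem sum_descFactorial_mul_descFactorial_div (hs : 0 < s) {i j k : ℕ} (hik : i ≤ k) :
    ∑ m ∈ Finset.range (k + 1), (i.descFactorial m : ℝ) / i.factorial *
        (j.descFactorial m / j.factorial) / (m.factorial * risingFactorial s m) =
      risingFactorial s (i + j) /
        (i.factorial * j.factorial * risingFactorial s i * risingFactorial s j) := by
  have h := sum_choose_mul_descFactorial_div_risingFactorial hs i j
  rw [← Finset.sum_subset (Finset.range_mono (Nat.succ_le_succ hik))]
  · rw [show risingFactorial s (i + j) /
        (i.factorial * j.factorial * risingFactorial s i * risingFactorial s j) =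
        1 / (i.factorial * j.factorial) *
          (risingFactorial s (i + j) / (risingFactorial s i * risingFactorial s j)) by
      have p1 := (risingFactorial_pos hs i).ne'
      have p2 := (risingFactorial_pos hs j).ne'
      field_simp, ← h, Finset.mul_sum]
    refine Finset.sum_congr rfl fun m _ => ?_
    rw [Nat.descFactorial_eq_factorial_mul_choose i]
    push_cast
    have p1 := (risingFactorial_pos hs m).ne'
    field_simp
  · intro m _ hm
    have : i < m := by simpa using hm
    simp [Nat.descFactorial_eq_zero_iff_lt.2 this]

/-- The quotient of the falling factorial of i by i! is 1/(i - m)!, or 0 if i < m, so this is the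
binomial theorem of degree k - 2m with (AB)^m factored out. -/
theorem sum_antidiagonal_descFactorial (A B : ℝ) (m k : ℕ) :
    ∑ p ∈ Finset.HasAntidiagonal.antidiagonal k, A ^ p.1 * (p.1.descFactorial m / p.1.factorial) *
        (B ^ p.2 * (p.2.descFactorial m / p.2.factorial)) =
      (k.descFactorial (2 * m) / k.factorial) * (A * B) ^ m * (A + B) ^ (k - 2 * m) := by
  induction m generalizing k with
  | zero =>
    simp only [Nat.descFactorial_zero, Nat.cast_one, mul_zero, pow_zero, mul_one, Nat.sub_zero]
    rw [Commute.add_pow' (Commute.all A B), Finset.mul_sum]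
    refine Finset.sum_congr rfl fun p hp => ?_
    rw [← Finset.HasAntidiagonal.mem_antidiagonal.1 hp,
      ← Nat.add_choose_mul_factorial_mul_factorial p.1 p.2]
    have : ((p.1 + p.2).choose p.2 : ℝ) ≠ 0 := by
      exact_mod_cast (Nat.choose_pos (Nat.le_add_left _ _)).ne'
    rw [Nat.choose_symm_add]
    push_cast
    rw [nsmul_eq_mul]
    field_simp
  | succ m ih =>
    match k with
    | 0 => simp
    | 1 => simp [Finset.Nat.antidiagonal_succ, Nat.descFactorial_eq_zero_iff_lt.2 
        (by omega : 1 < 2 * (m + 1))]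
    | k + 2 =>
      have hstep (C : ℝ) (i : ℕ) : C ^ (i + 1) * ((i + 1).descFactorial (m + 1) /
          (i + 1).factorial : ℝ) = C * (C ^ i * (i.descFactorial m / i.factorial)) := by
        rw [Nat.succ_descFactorial_succ, Nat.factorial_succ]
        push_cast
        field_simp
        ring
      rw [Finset.Nat.sum_antidiagonal_succ, Finset.Nat.sum_antidiagonal_succ']
      simp only [Nat.zero_descFactorial_succ, hstep]
      have e : ∀ p : ℕ × ℕ, A * (A ^ p.1 * (p.1.descFactorial m / p.1.factorial : ℝ)) *
          (B * (B ^ p.2 * (p.2.descFactorial m / p.2.factorial))) =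
          (A * B) * (A ^ p.1 * (p.1.descFactorial m / p.1.factorial) *
          (B ^ p.2 * (p.2.descFactorial m / p.2.factorial))) := fun p => by ring
      simp only [e, ← Finset.mul_sum, ih]
      rw [show 2 * (m + 1) = 2 * m + 1 + 1 by ring, Nat.succ_descFactorial_succ,
        Nat.succ_descFactorial_succ, Nat.factorial_succ (k + 1), Nat.factorial_succ k,
        show k + 2 - (2 * m + 1 + 1) = k - 2 * m by omega]
      push_cast
      field_simp
      ring

/-- The coefficients of the product of two normalized Bessel series. -/
theorem sum_antidiagonal_pow_div_risingFactorial (hs : 0 < s) (A B : ℝ) (k : ℕ) :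
    ∑ p ∈ Finset.HasAntidiagonal.antidiagonal k, A ^ p.1 / (p.1.factorial * risingFactorial s p.1) *
        (B ^ p.2 / (p.2.factorial * risingFactorial s p.2)) =
      1 / (k.factorial * risingFactorial s k) * ∑ m ∈ Finset.range (k + 1),
        (k.descFactorial (2 * m)) * (A * B) ^ m * (A + B) ^ (k - 2 * m) /
          (m.factorial * risingFactorial s m) := by
  have hk := (risingFactorial_pos hs k).ne'
  -- Chu–Vandermonde read from right to left: 1/((s)ᵢ(s)ⱼ) becomes 1/(s)ₖ times a sum over m.
  have h : ∀ p ∈ Finset.HasAntidiagonal.antidiagonal k,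
      A ^ p.1 / (p.1.factorial * risingFactorial s p.1) *
        (B ^ p.2 / (p.2.factorial * risingFactorial s p.2)) =
      1 / risingFactorial s k * ∑ m ∈ Finset.range (k + 1),
        (A ^ p.1 * (p.1.descFactorial m / p.1.factorial) *
          (B ^ p.2 * (p.2.descFactorial m / p.2.factorial))) *
            (1 / (m.factorial * risingFactorial s m)) := by
    intro p hp
    have hp := Finset.HasAntidiagonal.mem_antidiagonal.1 hp
    have h1 := sum_descFactorial_mul_descFactorial_div hs (i := p.1) (j := p.2) (k := k) (by omega)
    have h2 : ∑ m ∈ Finset.range (k + 1),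
        (A ^ p.1 * (p.1.descFactorial m / p.1.factorial : ℝ) *
          (B ^ p.2 * (p.2.descFactorial m / p.2.factorial))) *
            (1 / (m.factorial * risingFactorial s m)) = A ^ p.1 * B ^ p.2 *
        ∑ m ∈ Finset.range (k + 1), (p.1.descFactorial m : ℝ) / p.1.factorial *
        (p.2.descFactorial m / p.2.factorial) / (m.factorial * risingFactorial s m) := by
      rw [Finset.mul_sum]
      exact Finset.sum_congr rfl fun m _ => by ring
    rw [h2, h1, hp]
    have p1 := (risingFactorial_pos hs p.1).ne'
    have p2 := (risingFactorial_pos hs p.2).ne'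
    field_simp
  rw [Finset.sum_congr rfl h, ← Finset.mul_sum, Finset.sum_comm]
  simp only [← Finset.sum_mul, sum_antidiagonal_descFactorial]
  rw [Finset.mul_sum, Finset.mul_sum]
  refine Finset.sum_congr rfl fun m _ => ?_
  have p1 := (risingFactorial_pos hs m).ne'
  field_simp

end RisingFactorial

/-! ### Moments of the Beta law -/

section BetaMoments

variable {α β : ℝ}

theorem betaPDFReal_nonneg (hα : 0 < α) (hβ : 0 < β) (x : ℝ) : 0 ≤ betaPDFReal α β x := by
  by_cases h : 0 < x ∧ x < 1
  · exact (betaPDFReal_pos h.1 h.2 hα hβ).le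
  · simp [betaPDFReal, h]

theorem integral_betaPDFReal (hα : 0 < α) (hβ : 0 < β) : ∫ x, betaPDFReal α β x = 1 := by
  rw [integral_eq_lintegral_of_nonneg_ae (ae_of_all _ (betaPDFReal_nonneg hα hβ))
    (measurable_betaPDFReal α β).aestronglyMeasurable]
  have := lintegral_betaPDF_eq_one hα hβ
  simp only [betaPDF] at this
  simp [this]

theorem measurable_betaPDF (α β : ℝ) : Measurable (betaPDF α β) :=
  (measurable_betaPDFReal α β).ennreal_ofReal

theorem ae_mem_Ioo_betaMeasure (α β : ℝ) : ∀ᵐ x ∂betaMeasure α β, x ∈ Set.Ioo (0 : ℝ) 1 := by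
  rw [betaMeasure, ae_withDensity_iff (measurable_betaPDF α β)]
  refine ae_of_all _ fun x hx => ?_
  by_contra h
  exact hx (by simp [betaPDF, betaPDFReal, show ¬ (0 < x ∧ x < 1) from h])

/-- The factor x^m only shifts α to α + m, so a moment is a ratio of normalizing constants. -/
theorem pow_mul_betaPDFReal (hα : 0 < α) (hβ : 0 < β) (m : ℕ) (x : ℝ) :
    betaPDFReal α β x * x ^ m =
      risingFactorial α m / risingFactorial (α + β) m * betaPDFReal (α + m) β x := by
  unfold betaPDFReal
  split_ifs with h
  · have hαm : 0 < α + m := by positivity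
    have e : beta (α + m) β = beta α β * (risingFactorial α m / risingFactorial (α + β) m) := by
      rw [beta, beta, add_right_comm, Gamma_add_natCast_eq_risingFactorial_mul hα,
        Gamma_add_natCast_eq_risingFactorial_mul (add_pos hα hβ)]
      have p1 := (risingFactorial_pos hα m).ne'
      have p2 := (risingFactorial_pos (add_pos hα hβ) m).ne'
      have p3 := (Real.Gamma_pos_of_pos (add_pos hα hβ)).ne'
      field_simp
    have p1 := (risingFactorial_pos hα m).ne'
    have p2 := (risingFactorial_pos (add_pos hα hβ) m).ne'
    have p3 := (beta_pos hα hβ).ne'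
    rw [e, show α + m - 1 = (α - 1) + m by ring, Real.rpow_add_natCast h.1.ne']
    field_simp
  · simp

theorem integral_pow_betaMeasure (hα : 0 < α) (hβ : 0 < β) (m : ℕ) :
    ∫ x, x ^ m ∂betaMeasure α β = risingFactorial α m / risingFactorial (α + β) m := by
  rw [betaMeasure, integral_withDensity_eq_integral_toReal_smul (measurable_betaPDF α β)
    (ae_of_all _ fun x => ENNReal.ofReal_lt_top)]
  have h : ∀ x, (betaPDF α β x).toReal • x ^ m =
      risingFactorial α m / risingFactorial (α + β) m * betaPDFReal (α + m) β x := fun x => by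
    rw [betaPDF, ENNReal.toReal_ofReal (betaPDFReal_nonneg hα hβ x), smul_eq_mul,
      pow_mul_betaPDFReal hα hβ]
  simp only [h]
  rw [integral_const_mul, integral_betaPDFReal (by positivity) hβ, mul_one]

end BetaMoments

/-! ### Existence of Gegenbauer laws -/

/-- `ν` has the moments of the symmetric law on `[-1, 1]` with density proportional to
`(1 - x²)^(s - 3/2)`, which for `s = 1/2` degenerates to the uniform law on `{-1, 1}`. -/
structure IsGegenbauerLaw (s : ℝ) (ν : Measure ℝ) : Prop where
  isProbabilityMeasure : IsProbabilityMeasure ν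
  abs_le_one : ∀ᵐ x ∂ν, |x| ≤ 1
  integral_pow_odd : ∀ m : ℕ, ∫ x, x ^ (2 * m + 1) ∂ν = 0
  integral_pow_even : ∀ m : ℕ,
    ∫ x, x ^ (2 * m) ∂ν = (2 * m).factorial / (4 ^ m * m.factorial * risingFactorial s m)

theorem integrable_pow_of_ae_abs_le {ν : Measure ℝ} [IsFiniteMeasure ν] {R : ℝ}
    (h : ∀ᵐ x ∂ν, |x| ≤ R) (n : ℕ) : Integrable (fun x => x ^ n) ν := by
  refine Integrable.of_bound (by fun_prop) (R ^ n) ?_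
  filter_upwards [h] with x hx
  rw [norm_pow, Real.norm_eq_abs]
  gcongr

/-- The symmetric law on `[-1, 1]` of `±√W`, with `W` distributed as `κ`. -/
noncomputable def symmSqrtLaw (κ : Measure ℝ) : Measure ℝ :=
  (2⁻¹ : ENNReal) • (κ.map Real.sqrt + κ.map fun x => -√x)

theorem isProbabilityMeasure_symmSqrtLaw (κ : Measure ℝ) [IsProbabilityMeasure κ] :
    IsProbabilityMeasure (symmSqrtLaw κ) := by
  constructor
  have : IsProbabilityMeasure (κ.map Real.sqrt) :=
    Measure.isProbabilityMeasure_map (by fun_prop)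
  have : IsProbabilityMeasure (κ.map fun x => -√x) :=
    Measure.isProbabilityMeasure_map (by fun_prop)
  simp only [symmSqrtLaw, Measure.smul_apply, Measure.add_apply, measure_univ, smul_eq_mul]
  rw [one_add_one_eq_two]
  exact ENNReal.inv_mul_cancel (by simp) (by simp)

theorem ae_symmSqrtLaw {κ : Measure ℝ} (h : ∀ᵐ x ∂κ, x ≤ 1) :
    ∀ᵐ x ∂symmSqrtLaw κ, |x| ≤ 1 := by
  refine Measure.ae_smul_measure ?_ _
  have hS : MeasurableSet {x : ℝ | |x| ≤ 1} := measurableSet_le (by fun_prop) (by fun_prop)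
  rw [ae_add_measure_iff, ae_map_iff (by fun_prop) hS, ae_map_iff (by fun_prop) hS]
  constructor <;> filter_upwards [h] with x hx <;>
    simpa [abs_of_nonneg (Real.sqrt_nonneg x)] using hx

theorem integral_pow_symmSqrtLaw {κ : Measure ℝ} [IsProbabilityMeasure κ]
    (h : ∀ᵐ x ∂κ, x ≤ 1) (n : ℕ) :
    ∫ x, x ^ n ∂symmSqrtLaw κ = 2⁻¹ * (∫ x, √x ^ n ∂κ + ∫ x, (-√x) ^ n ∂κ) := by
  have hi (f : ℝ → ℝ) (hf : Measurable f) (hb : ∀ x, x ≤ 1 → |f x| ≤ 1) :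
      Integrable (fun x => x ^ n) (κ.map f) := by
    have : IsProbabilityMeasure (κ.map f) := Measure.isProbabilityMeasure_map hf.aemeasurable
    refine integrable_pow_of_ae_abs_le (R := 1) ?_ n
    rw [ae_map_iff hf.aemeasurable (measurableSet_le (by fun_prop) (by fun_prop))]
    filter_upwards [h] with x hx using hb x hx
  have h1 := hi Real.sqrt (by fun_prop) fun x hx => by
    simpa [abs_of_nonneg (Real.sqrt_nonneg x)] using hx
  have h2 := hi (fun x => -√x) (by fun_prop) fun x hx => by
    simpa [abs_of_nonneg (Real.sqrt_nonneg x)] using hx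
  rw [symmSqrtLaw, integral_smul_measure, integral_add_measure h1 h2,
    integral_map (by fun_prop) (by fun_prop), integral_map (by fun_prop) (by fun_prop)]
  simp

/-- The random sign kills odd moments, and the 2m-th moment of ±√W is the m-th moment of W. -/
theorem isGegenbauerLaw_symmSqrtLaw {s : ℝ} {κ : Measure ℝ} [IsProbabilityMeasure κ]
    (h : ∀ᵐ x ∂κ, x ∈ Set.Icc (0 : ℝ) 1)
    (hm : ∀ m : ℕ, ∫ x, x ^ m ∂κ = risingFactorial (1 / 2) m / risingFactorial s m) :
    IsGegenbauerLaw s (symmSqrtLaw κ) where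
  isProbabilityMeasure := isProbabilityMeasure_symmSqrtLaw κ
  abs_le_one := ae_symmSqrtLaw (h.mono fun _ hx => hx.2)
  integral_pow_odd m := by
    rw [integral_pow_symmSqrtLaw (h.mono fun _ hx => hx.2)]
    simp [Odd.neg_pow (odd_two_mul_add_one m), integral_neg]
  integral_pow_even m := by
    rw [integral_pow_symmSqrtLaw (h.mono fun _ hx => hx.2)]
    have e : ∫ x, √x ^ (2 * m) ∂κ = ∫ x, x ^ m ∂κ := by
      refine integral_congr_ae ?_
      filter_upwards [h] with x hx
      rw [pow_mul, Real.sq_sqrt hx.1]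
    simp only [Even.neg_pow (even_two_mul m), e, hm]
    rw [risingFactorial_half, div_div]
    ring

theorem exists_isGegenbauerLaw {s : ℝ} (hs : 1 / 2 ≤ s) : ∃ ν, IsGegenbauerLaw s ν := by
  rcases hs.eq_or_lt with rfl | hs
  -- At s = 1/2 the second Beta parameter s - 1/2 vanishes; the limiting law of X² is the point mass
  -- at 1.
  · refine ⟨_, isGegenbauerLaw_symmSqrtLaw (κ := Measure.dirac 1) ?_ fun m => ?_⟩
    · exact (ae_dirac_iff (p := fun x : ℝ => x ∈ Set.Icc (0 : ℝ) 1) measurableSet_Icc).2 (by simp)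
    · rw [div_self (risingFactorial_pos (by norm_num) m).ne']
      simp
  · have h : 0 < s - 1 / 2 := by linarith
    have := isProbabilityMeasureBeta one_half_pos h
    refine ⟨_, isGegenbauerLaw_symmSqrtLaw (κ := betaMeasure (1 / 2) (s - 1 / 2)) ?_ fun m => ?_⟩
    · filter_upwards [ae_mem_Ioo_betaMeasure _ _] with x hx using Set.Ioo_subset_Icc_self hx
    · rw [integral_pow_betaMeasure one_half_pos h]
      congr 2
      ring

theorem HasSum.congr_terms {ι α : Type*} [AddCommMonoid α] [TopologicalSpace α] {f g : ι → α}
    {x : α} (h : HasSum f x) (hfg : ∀ i, f i = g i) : HasSum g x :=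
  funext hfg ▸ h

/-! ### Bessel transforms as generating series of even moments -/

section BesselSeries

variable {N : ℕ} {θ : ℝ}

theorem besselBC_eq_tsum (h : 0 < θ * N) (c z : ℝ) :
    besselBC N θ c z = ∑' k : ℕ, ((z / 2) ^ 2 * c ^ 2) ^ k /
      (k.factorial * risingFactorial (θ * N) k) := by
  refine tsum_congr fun k => ?_
  have p1 := (risingFactorial_pos h k).ne'
  have p2 := (Real.Gamma_pos_of_pos h).ne'
  rw [Gamma_add_natCast_eq_risingFactorial_mul h, pow_mul]
  field_simp

theorem summable_pow_div_factorial_mul_risingFactorial {s : ℝ} (hs : 0 < s) (x : ℝ) :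
    Summable fun k : ℕ => x ^ k / (k.factorial * risingFactorial s k) := by
  refine Summable.of_norm_bounded (Real.summable_pow_div_factorial (|x| / s)) fun k => ?_
  rw [norm_div, norm_pow, Real.norm_eq_abs, norm_mul,
    Real.norm_of_nonneg (risingFactorial_pos hs k).le,
    Real.norm_natCast, div_pow, div_div, mul_comm]
  have := pow_le_risingFactorial hs k
  gcongr

theorem hasSum_besselBC (h : 0 < θ * N) (c z : ℝ) :
    HasSum (fun k : ℕ => ((z / 2) ^ 2) ^ k / (k.factorial * risingFactorial (θ * N) k) *
      (c ^ 2) ^ k) (besselBC N θ c z) := by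
  rw [besselBC_eq_tsum h]
  convert (summable_pow_div_factorial_mul_risingFactorial h ((z / 2) ^ 2 * c ^ 2)).hasSum using 2
  rw [mul_pow]
  ring

theorem besselBC_coeff_nonneg (h : 0 < θ * N) (z : ℝ) (k : ℕ) :
    0 ≤ ((z / 2) ^ 2) ^ k / (k.factorial * risingFactorial (θ * N) k) := by
  have := risingFactorial_pos h k
  positivity

theorem besselBC_nonneg (h : 0 < θ * N) (c z : ℝ) : 0 ≤ besselBC N θ c z :=
  (hasSum_besselBC h c z).nonneg fun k =>
    mul_nonneg (besselBC_coeff_nonneg h z k) (by positivity)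

theorem besselBC_mono (h : 0 < θ * N) {c d : ℝ} (hcd : c ^ 2 ≤ d ^ 2) (z : ℝ) :
    besselBC N θ c z ≤ besselBC N θ d z :=
  hasSum_le (fun k => mul_le_mul_of_nonneg_left (by gcongr) (besselBC_coeff_nonneg h z k))
    (hasSum_besselBC h c z) (hasSum_besselBC h d z)

theorem measurable_besselBC (h : 0 < θ * N) (z : ℝ) : Measurable fun c => besselBC N θ c z := by
  refine measurable_of_tendsto_metrizable (f := fun (n : ℕ) (c : ℝ) => ∑ k ∈ Finset.range n,
    ((z / 2) ^ 2) ^ k / (k.factorial * risingFactorial (θ * N) k) * (c ^ 2) ^ k)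
    (fun n => by fun_prop) ?_
  exact tendsto_pi_nhds.2 fun c => (hasSum_besselBC h c z).tendsto_sum_nat

/-- If all the Bessel transforms of a law are finite, so are its even moments. -/
theorem integrable_sq_pow (h : 0 < θ * N) {μ : Measure ℝ}
    (hi : ∀ z : ℝ, Integrable (fun c => besselBC N θ c z) μ) (k : ℕ) :
    Integrable (fun c => (c ^ 2) ^ k) μ := by
  have p := risingFactorial_pos h k
  -- At z = 2 the powers of z / 2 are 1, and a single term is at most the whole nonnegative series.
  refine ((hi 2).const_mul (k.factorial * risingFactorial (θ * N) k)).mono' (by fun_prop)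
    (ae_of_all _ fun c => ?_)
  have := le_hasSum (hasSum_besselBC h c 2) k fun j _ =>
    mul_nonneg (besselBC_coeff_nonneg h 2 j) (by positivity)
  rw [Real.norm_of_nonneg (by positivity), ← div_le_iff₀' (by positivity)]
  refine le_trans (le_of_eq ?_) this
  simp
  ring

/-- The Bessel transform of a law is the generating series of its even moments. -/
theorem hasSum_integral_besselBC (h : 0 < θ * N) {μ : Measure ℝ}
    (hi : ∀ z : ℝ, Integrable (fun c => besselBC N θ c z) μ) (z : ℝ) :
    HasSum (fun k : ℕ => ((z / 2) ^ 2) ^ k / (k.factorial * risingFactorial (θ * N) k) *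
      ∫ c, (c ^ 2) ^ k ∂μ) (∫ c, besselBC N θ c z ∂μ) := by
  have hint (k : ℕ) : Integrable (fun c : ℝ => ((z / 2) ^ 2) ^ k /
      (k.factorial * risingFactorial (θ * N) k) * (c ^ 2) ^ k) μ :=
    (integrable_sq_pow h hi k).const_mul _
  have hnn (k : ℕ) (c : ℝ) : 0 ≤ ((z / 2) ^ 2) ^ k /
      (k.factorial * risingFactorial (θ * N) k) * (c ^ 2) ^ k :=
    mul_nonneg (besselBC_coeff_nonneg h z k) (by positivity)
  have hs : Summable fun k : ℕ => ∫ c, ‖((z / 2) ^ 2) ^ k /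
      (k.factorial * risingFactorial (θ * N) k) * (c ^ 2) ^ k‖ ∂μ := by
    refine summable_of_sum_range_le (c := ∫ c, besselBC N θ c z ∂μ)
      (fun k => integral_nonneg fun c => norm_nonneg _) fun n => ?_
    rw [← integral_finsetSum _ fun k _ => (hint k).norm]
    refine integral_mono (integrable_finsetSum _ fun k _ => (hint k).norm) (hi z) fun c => ?_
    simp only [Real.norm_of_nonneg (hnn _ c)]
    exact sum_le_hasSum _ (fun k _ => hnn k c) (hasSum_besselBC h c z)
  have := hasSum_integral_of_summable_integral_norm hint hs
  simp only [(hasSum_besselBC h _ z).tsum_eq, integral_const_mul] at this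
  exact this

/-- The product formula for the Bessel series in terms of power series coefficients. -/
theorem hasSum_besselBC_mul_besselBC (h : 0 < θ * N) (a b z : ℝ) :
    HasSum (fun k : ℕ => ((z / 2) ^ 2) ^ k / (k.factorial * risingFactorial (θ * N) k) *
      ∑ m ∈ Finset.range (k + 1),
        (k.descFactorial (2 * m)) * (a ^ 2 * b ^ 2) ^ m * (a ^ 2 + b ^ 2) ^ (k - 2 * m) /
          (m.factorial * risingFactorial (θ * N) m))
      (besselBC N θ a z * besselBC N θ b z) := by
  have ha := (hasSum_besselBC h a z).summable.norm
  have hb := (hasSum_besselBC h b z).summable.norm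
  have := (summable_norm_sum_mul_antidiagonal_of_summable_norm ha hb).of_norm.hasSum
  rw [← tsum_mul_tsum_eq_tsum_sum_antidiagonal_of_summable_norm ha hb,
    (hasSum_besselBC h a z).tsum_eq, (hasSum_besselBC h b z).tsum_eq] at this
  refine HasSum.congr_terms this fun k => ?_
  have e := sum_antidiagonal_pow_div_risingFactorial h (a ^ 2) (b ^ 2) k
  rw [div_eq_mul_one_div (((z / 2) ^ 2) ^ k), mul_assoc, ← e, Finset.mul_sum]
  refine Finset.sum_congr rfl fun p hp => ?_
  rw [← Finset.HasAntidiagonal.mem_antidiagonal.1 hp, pow_add]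
  ring

end BesselSeries

/-! ### Uniqueness of coefficients and of bounded laws -/

theorem coeff_eq_zero_of_hasSum_pow_zero {d : ℕ → ℝ}
    (h : ∀ z : ℝ, HasSum (fun n => d n * z ^ n) 0) : d = 0 := by
  have hp : HasFPowerSeriesAt (fun _ : ℝ => (0 : ℝ)) (FormalMultilinearSeries.ofScalars ℝ d) 0 := by
    rw [hasFPowerSeriesAt_iff]
    refine Eventually.of_forall fun z => ?_
    simpa [FormalMultilinearSeries.coeff_ofScalars, mul_comm] using h z
  have h0 := hp.eq_zero
  ext n
  have := congrArg (fun p => FormalMultilinearSeries.coeff p n) h0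
  rwa [FormalMultilinearSeries.coeff_ofScalars] at this

theorem coeff_eq_of_hasSum_sq_pow {p q : ℕ → ℝ} {F : ℝ → ℝ}
    (hp : ∀ z : ℝ, HasSum (fun k => (z ^ 2) ^ k * p k) (F z))
    (hq : ∀ z : ℝ, HasSum (fun k => (z ^ 2) ^ k * q k) (F z)) : p = q := by
  have hinj : Function.Injective fun k : ℕ => 2 * k := fun i j hij => by simpa using hij
  -- The difference, as a power series in z, with zero odd coefficients.
  have h : ∀ z : ℝ, HasSum
      (fun n => (if Even n then p (n / 2) - q (n / 2) else 0) * z ^ n) 0 := fun z => by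
    rw [← Function.Injective.hasSum_iff hinj]
    · rw [← sub_self (F z)]
      refine HasSum.congr_terms ((hp z).sub (hq z)) fun k => ?_
      simp only [Function.comp_apply, even_two_mul, if_true, pow_mul,
        Nat.mul_div_cancel_left k two_pos]
      ring
    · intro n hn
      rw [if_neg, zero_mul]
      rintro ⟨k, rfl⟩
      exact hn ⟨k, two_mul k⟩
  ext k
  have := congrFun (coeff_eq_zero_of_hasSum_pow_zero h) (2 * k)
  simpa [sub_eq_zero] using this

/-- The Bessel transform determines the even moments. -/
theorem integral_sq_pow_eq {N : ℕ} {θ : ℝ} (h : 0 < θ * N) {μ ν : Measure ℝ}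
    (hμ : ∀ z : ℝ, Integrable (fun c => besselBC N θ c z) μ)
    (hν : ∀ z : ℝ, Integrable (fun c => besselBC N θ c z) ν)
    (heq : ∀ z : ℝ, ∫ c, besselBC N θ c z ∂μ = ∫ c, besselBC N θ c z ∂ν) (k : ℕ) :
    ∫ c, (c ^ 2) ^ k ∂μ = ∫ c, (c ^ 2) ^ k ∂ν := by
  have key (κ : Measure ℝ) (hκ : ∀ z : ℝ, Integrable (fun c => besselBC N θ c z) κ) (z : ℝ) :
      HasSum (fun k : ℕ => (z ^ 2) ^ k *
        ((∫ c, (c ^ 2) ^ k ∂κ) / (k.factorial * risingFactorial (θ * N) k)))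
        (∫ c, besselBC N θ c (2 * z) ∂κ) := by
    convert hasSum_integral_besselBC h hκ (2 * z) using 2
    rw [mul_div_cancel_left₀ z two_ne_zero]
    ring
  have := congrFun (coeff_eq_of_hasSum_sq_pow (key μ hμ)
    fun z => by simpa [heq] using key ν hν z) k
  have p := risingFactorial_pos h k
  rwa [div_left_inj' (by positivity)] at this

/-- The characteristic function of a bounded random variable is the exponential generating
series of its moments. -/
theorem hasSum_charFun {ν : Measure ℝ} [IsProbabilityMeasure ν] {R : ℝ}
    (h : ∀ᵐ x ∂ν, |x| ≤ R) (t : ℝ) :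
    HasSum (fun n : ℕ => (t * Complex.I) ^ n / n.factorial * ((∫ x, x ^ n ∂ν : ℝ) : ℂ))
      (charFun ν t) := by
  have key := hasSum_integral_of_dominated_convergence (μ := ν)
    (F := fun (n : ℕ) (x : ℝ) => (t * x * Complex.I) ^ n / (n.factorial : ℂ))
    (f := fun x => Complex.exp (t * x * Complex.I))
    (fun n _ => (|t| * R) ^ n / n.factorial) (fun n => by fun_prop) (fun n => ?_)
    (ae_of_all _ fun _ => Real.summable_pow_div_factorial _) (by fun_prop)
    (ae_of_all _ fun x => ?_)
  · rw [charFun_apply_real]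
    refine HasSum.congr_terms key fun n => ?_
    rw [← integral_complex_ofReal, ← integral_const_mul]
    congr 1
    ext x
    push_cast
    ring
  · filter_upwards [h] with x hx
    rw [norm_div, norm_pow, norm_mul, norm_mul, Complex.norm_I, mul_one, Complex.norm_real,
      Complex.norm_real, Complex.norm_natCast, Real.norm_eq_abs, Real.norm_eq_abs]
    gcongr
  · rw [Complex.exp_eq_exp_ℂ]
    exact NormedSpace.expSeries_div_hasSum_exp _

/-- Bounded random variables with the same moments have the same law. -/
theorem eq_of_integral_pow_eq {μ ν : Measure ℝ} [IsProbabilityMeasure μ] [IsProbabilityMeasure ν]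
    {R : ℝ} (hμ : ∀ᵐ x ∂μ, |x| ≤ R) (hν : ∀ᵐ x ∂ν, |x| ≤ R)
    (h : ∀ n : ℕ, ∫ x, x ^ n ∂μ = ∫ x, x ^ n ∂ν) : μ = ν := by
  refine Measure.ext_of_charFun (funext fun t => ?_)
  refine (hasSum_charFun hμ t).unique ?_
  simpa [h] using hasSum_charFun hν t

/-- Markov's inequality for f^k gives μ(f ≥ r) ≤ (R/r)^k, which tends to 0 for every r > R. -/
theorem ae_le_of_integral_pow_le {Ω : Type*} [MeasurableSpace Ω] {μ : Measure Ω}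
    [IsFiniteMeasure μ] {f : Ω → ℝ} {R : ℝ} (hR : 0 ≤ R)
    (hf : ∀ ω, 0 ≤ f ω) (hi : ∀ k : ℕ, Integrable (fun ω => f ω ^ k) μ)
    (h : ∀ k : ℕ, ∫ ω, f ω ^ k ∂μ ≤ R ^ k) : ∀ᵐ ω ∂μ, f ω ≤ R := by
  have key : ∀ n : ℕ, ∀ᵐ ω ∂μ, f ω < R + 1 / ((n : ℝ) + 1) := by
    intro n
    set r := R + 1 / ((n : ℝ) + 1) with hr
    have hRr : R < r := by rw [hr]; linarith [Nat.one_div_pos_of_nat (α := ℝ) (n := n)]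
    have hr0 : 0 < r := hR.trans_lt hRr
    have hk : ∀ k : ℕ, μ.real {ω | r ≤ f ω} ≤ (R / r) ^ k := fun k => by
      have h1 := mul_meas_ge_le_integral_of_nonneg (ae_of_all μ fun ω => pow_nonneg (hf ω) k)
        (hi k) (r ^ k)
      rw [div_pow, le_div_iff₀' (by positivity)]
      refine le_trans (mul_le_mul_of_nonneg_left (measureReal_mono ?_) (by positivity))
        (h1.trans (h k))
      intro ω hω
      exact pow_le_pow_left₀ hr0.le hω k
    have h0 : μ.real {ω | r ≤ f ω} ≤ 0 := ge_of_tendsto'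
      (tendsto_pow_atTop_nhds_zero_of_lt_one (by positivity) ((div_lt_one hr0).2 hRr)) hk
    have h0 : μ {ω | r ≤ f ω} = 0 :=
      (measureReal_eq_zero_iff).1 (le_antisymm h0 measureReal_nonneg)
    rw [ae_iff]
    simpa using h0
  filter_upwards [ae_all_iff.2 key] with ω hω
  refine ge_of_tendsto' (f := fun n : ℕ => R + 1 / ((n : ℝ) + 1)) (x := atTop) ?_
    fun n => (hω n).le
  simpa using tendsto_const_nhds.add (tendsto_one_div_add_atTop_nhds_zero_nat (𝕜 := ℝ))

theorem sum_range_two_mul_eq {M : Type*} [AddCommMonoid M] (f : ℕ → M) (n : ℕ) :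
    ∑ i ∈ Finset.range (2 * n), f i = ∑ m ∈ Finset.range n, (f (2 * m) + f (2 * m + 1)) := by
  induction n with
  | zero => simp
  | succ n ih =>
    rw [show 2 * (n + 1) = 2 * n + 1 + 1 by ring, Finset.sum_range_succ, Finset.sum_range_succ, ih,
      Finset.sum_range_succ _ n, add_assoc]

/-! ### Existence and uniqueness of the rectangular sum -/

section RectSum

variable {N : ℕ} {θ a b : ℝ}

theorem IsGegenbauerLaw.integral_add_mul_pow {s : ℝ} (hs : 0 < s) {ν : Measure ℝ}
    (hν : IsGegenbauerLaw s ν) (a b : ℝ) (k : ℕ) :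
    ∫ x, (a ^ 2 + b ^ 2 + 2 * a * b * x) ^ k ∂ν = ∑ m ∈ Finset.range (k + 1),
      (k.descFactorial (2 * m)) * (a ^ 2 * b ^ 2) ^ m * (a ^ 2 + b ^ 2) ^ (k - 2 * m) /
        (m.factorial * risingFactorial s m) := by
  have := hν.isProbabilityMeasure
  -- The binomial sum is padded with zero terms up to 2(k + 1), to split into even and odd pairs;
  -- the odd ones integrate to 0.
  have hpow (x : ℝ) : (a ^ 2 + b ^ 2 + 2 * a * b * x) ^ k =
      ∑ i ∈ Finset.range (2 * (k + 1)), (k.choose i * (a ^ 2 + b ^ 2) ^ (k - i) *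
        (2 * a * b) ^ i) * x ^ i := by
    rw [add_comm, add_pow]
    refine Finset.sum_subset_zero_on_sdiff (Finset.range_mono (by omega)) ?_ ?_
    · intro i hi
      have : k < i := by
        have := (Finset.mem_sdiff.1 hi).2
        simpa using this
      simp [Nat.choose_eq_zero_of_lt this]
    · intro i _
      rw [mul_pow _ x]
      ring
  simp only [hpow]
  rw [integral_finsetSum _ fun i _ =>
    (integrable_pow_of_ae_abs_le hν.abs_le_one i).const_mul _, sum_range_two_mul_eq]
  refine Finset.sum_congr rfl fun m _ => ?_
  rw [integral_const_mul, integral_const_mul, hν.integral_pow_odd, hν.integral_pow_even,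
    Nat.descFactorial_eq_factorial_mul_choose, pow_mul _ 2 m,
    show (2 * a * b) ^ 2 = 4 * (a ^ 2 * b ^ 2) by ring, mul_pow]
  have p := risingFactorial_pos hs m
  push_cast
  field_simp
  ring

theorem sq_add_sq_add_mul_nonneg (ha : 0 ≤ a) (hb : 0 ≤ b) {x : ℝ} (hx : |x| ≤ 1) :
    0 ≤ a ^ 2 + b ^ 2 + 2 * a * b * x := by
  nlinarith [mul_nonneg (mul_nonneg ha hb) (by linarith [(abs_le.1 hx).1] : 0 ≤ 1 + x),
    sq_nonneg (a - b)]

theorem sq_add_sq_add_mul_le (ha : 0 ≤ a) (hb : 0 ≤ b) {x : ℝ} (hx : |x| ≤ 1) :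
    a ^ 2 + b ^ 2 + 2 * a * b * x ≤ (a + b) ^ 2 := by
  nlinarith [mul_nonneg (mul_nonneg ha hb) (by linarith [(abs_le.1 hx).2] : 0 ≤ 1 - x)]

/-- The law of `√(a² + b² + 2abX)`, where `X` has law `ν`. -/
noncomputable def cosineLaw (a b : ℝ) (ν : Measure ℝ) : Measure ℝ :=
  ν.map fun x => √(a ^ 2 + b ^ 2 + 2 * a * b * x)

theorem ae_sq_cosineLaw (ha : 0 ≤ a) (hb : 0 ≤ b) {ν : Measure ℝ} (hν : ∀ᵐ x ∂ν, |x| ≤ 1) :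
    ∀ᵐ c ∂cosineLaw a b ν, c ^ 2 ≤ (a + b) ^ 2 := by
  rw [cosineLaw, ae_map_iff (by fun_prop) (measurableSet_le (by fun_prop) (by fun_prop))]
  filter_upwards [hν] with x hx
  rw [Real.sq_sqrt (sq_add_sq_add_mul_nonneg ha hb hx)]
  exact sq_add_sq_add_mul_le ha hb hx

theorem integral_sq_pow_cosineLaw (ha : 0 ≤ a) (hb : 0 ≤ b) {ν : Measure ℝ}
    (hν : ∀ᵐ x ∂ν, |x| ≤ 1) (k : ℕ) :
    ∫ c, (c ^ 2) ^ k ∂cosineLaw a b ν = ∫ x, (a ^ 2 + b ^ 2 + 2 * a * b * x) ^ k ∂ν := by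
  rw [cosineLaw, integral_map (by fun_prop) (by fun_prop)]
  refine integral_congr_ae ?_
  filter_upwards [hν] with x hx
  rw [Real.sq_sqrt (sq_add_sq_add_mul_nonneg ha hb hx)]

/-- The product formula for Bessel functions: the rectangular sum of `a` and `b` is distributed as
the third side of a triangle with sides `a`, `b` whose angle has a cosine of Gegenbauer law. -/
theorem isRectSumLaw_cosineLaw (h : 0 < θ * N) (ha : 0 ≤ a) (hb : 0 ≤ b) {ν : Measure ℝ}
    (hν : IsGegenbauerLaw (θ * N) ν) : IsRectSumLaw N θ a b (cosineLaw a b ν) := by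
  have := hν.isProbabilityMeasure
  have hprob : IsProbabilityMeasure (cosineLaw a b ν) :=
    Measure.isProbabilityMeasure_map (by fun_prop)
  have hi (z : ℝ) : Integrable (fun c => besselBC N θ c z) (cosineLaw a b ν) := by
    refine Integrable.of_bound (measurable_besselBC h z).aestronglyMeasurable
      (besselBC N θ (a + b) z) ?_
    filter_upwards [ae_sq_cosineLaw ha hb hν.abs_le_one] with c hc
    rw [Real.norm_of_nonneg (besselBC_nonneg h c z)]
    exact besselBC_mono h hc z
  refine ⟨hprob, ?_, hi, fun z => ?_⟩
  · rw [cosineLaw, ae_map_iff (by fun_prop) measurableSet_Ici]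
    exact ae_of_all _ fun x => Real.sqrt_nonneg _
  · refine (hasSum_integral_besselBC h hi z).unique ?_
    simpa only [integral_sq_pow_cosineLaw ha hb hν.abs_le_one, hν.integral_add_mul_pow h]
      using hasSum_besselBC_mul_besselBC h a b z

/-- A law carried by `[0, ∞)` is determined by its image under squaring. -/
theorem eq_of_map_sq_eq {μ ν : Measure ℝ} (hμ : ∀ᵐ c ∂μ, 0 ≤ c) (hν : ∀ᵐ c ∂ν, 0 ≤ c)
    (h : μ.map (fun c => c ^ 2) = ν.map fun c => c ^ 2) : μ = ν := by
  have key (κ : Measure ℝ) (hκ : ∀ᵐ c ∂κ, 0 ≤ c) :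
      (κ.map fun c => c ^ 2).map Real.sqrt = κ := by
    rw [Measure.map_map (by fun_prop) (by fun_prop)]
    conv_rhs => rw [← Measure.map_id (μ := κ)]
    refine Measure.map_congr ?_
    filter_upwards [hκ] with c hc using Real.sqrt_sq hc
  rw [← key μ hμ, h, key ν hν]

/-- Nothing bounds the support of μ a priori. Its even moments are those of `cosineLaw`, so at most
(a + b)^(2k), which bounds c²; then moments determine the law of c², and c ≥ 0 that of c. -/
theorem IsRectSumLaw.eq_cosineLaw (h : 0 < θ * N) (ha : 0 ≤ a) (hb : 0 ≤ b) {μ ν : Measure ℝ}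
    (hν : IsGegenbauerLaw (θ * N) ν) (hμ : IsRectSumLaw N θ a b μ) : μ = cosineLaw a b ν := by
  have hc := isRectSumLaw_cosineLaw h ha hb hν
  have := hμ.isProbabilityMeasure
  have := hc.isProbabilityMeasure
  have hm := integral_sq_pow_eq h hμ.integrable hc.integrable fun z => by
    rw [hμ.integral_eq, hc.integral_eq]
  have hcb := ae_sq_cosineLaw ha hb hν.abs_le_one
  have hle (k : ℕ) : ∫ c, (c ^ 2) ^ k ∂μ ≤ ((a + b) ^ 2) ^ k := by
    rw [hm]
    calc _ ≤ ∫ _, ((a + b) ^ 2) ^ k ∂cosineLaw a b ν := by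
          refine integral_mono_ae (integrable_sq_pow h hc.integrable k) (integrable_const _) ?_
          filter_upwards [hcb] with c hc
          gcongr
      _ = _ := by simp
  have hμb : ∀ᵐ c ∂μ, c ^ 2 ≤ (a + b) ^ 2 := ae_le_of_integral_pow_le (sq_nonneg _)
    (fun c => sq_nonneg c) (integrable_sq_pow h hμ.integrable) hle
  refine eq_of_map_sq_eq hμ.nonneg hc.nonneg ?_
  have hbd (κ : Measure ℝ) (hκ : ∀ᵐ c ∂κ, c ^ 2 ≤ (a + b) ^ 2) :
      ∀ᵐ y ∂κ.map fun c => c ^ 2, |y| ≤ (a + b) ^ 2 := by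
    rw [ae_map_iff (by fun_prop) (measurableSet_le (by fun_prop) (by fun_prop))]
    filter_upwards [hκ] with c hc
    rwa [abs_of_nonneg (sq_nonneg c)]
  have : IsProbabilityMeasure (μ.map fun c => c ^ 2) :=
    Measure.isProbabilityMeasure_map (by fun_prop)
  have : IsProbabilityMeasure ((cosineLaw a b ν).map fun c => c ^ 2) :=
    Measure.isProbabilityMeasure_map (by fun_prop)
  refine eq_of_integral_pow_eq (hbd μ hμb) (hbd _ hcb) fun n => ?_
  rw [integral_map (by fun_prop) (by fun_prop), integral_map (by fun_prop) (by fun_prop), hm]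

theorem existsUnique_isRectSumLaw (h : 1 / 2 ≤ θ * N) (ha : 0 ≤ a) (hb : 0 ≤ b) :
    ∃! μ : Measure ℝ, IsRectSumLaw N θ a b μ := by
  obtain ⟨ν, hν⟩ := exists_isGegenbauerLaw h
  have h0 : 0 < θ * N := by linarith
  exact ⟨_, isRectSumLaw_cosineLaw h0 ha hb hν, fun μ hμ => hμ.eq_cosineLaw h0 ha hb hν⟩

/-- The fluctuations of the squared rectangular sum have a rescaled Gegenbauer law. -/
theorem IsRectSumLaw.map_fluctuation (h : 0 < θ * N) (ha : 0 ≤ a) (hb : 0 ≤ b) {μ ν : Measure ℝ}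
    (hν : IsGegenbauerLaw (θ * N) ν) (hμ : IsRectSumLaw N θ a b μ) (r : ℝ) :
    μ.map (fun c => r * (c ^ 2 - (a ^ 2 + b ^ 2))) = ν.map fun x => r * (2 * a * b) * x := by
  rw [hμ.eq_cosineLaw h ha hb hν, cosineLaw, Measure.map_map (by fun_prop) (by fun_prop)]
  refine Measure.map_congr ?_
  filter_upwards [hν.abs_le_one] with x hx
  rw [Function.comp_apply, Real.sq_sqrt (sq_add_sq_add_mul_nonneg ha hb hx)]
  ring

end RectSum

/-! ### Gaussian limit of rescaled Gegenbauer laws -/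

section CentralLimit

/-- Only even moments survive, and their (2m)! cancels that of the exponential series. -/
theorem IsGegenbauerLaw.hasSum_charFun {s : ℝ} {ν : Measure ℝ} (hν : IsGegenbauerLaw s ν)
    (t : ℝ) :
    HasSum (fun m : ℕ => (((-(t ^ 2 / 4)) ^ m / (m.factorial * risingFactorial s m) : ℝ) : ℂ))
      (charFun ν t) := by
  have := hν.isProbabilityMeasure
  have hinj : Function.Injective fun k : ℕ => 2 * k := fun i j hij => by simpa using hij
  have key := _root_.hasSum_charFun hν.abs_le_one t
  rw [← Function.Injective.hasSum_iff hinj] at key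
  · refine HasSum.congr_terms key fun m => ?_
    have hf : ((2 * m).factorial : ℂ) ≠ 0 := by exact_mod_cast (2 * m).factorial_ne_zero
    rw [Function.comp_apply, hν.integral_pow_even, pow_mul, mul_pow, Complex.I_sq,
      show (-(t ^ 2 / 4)) ^ m = (-(t ^ 2)) ^ m / 4 ^ m by rw [← div_pow]; ring]
    push_cast
    field_simp
  · intro n hn
    obtain ⟨m, rfl⟩ : Odd n := by
      rw [← Nat.not_even_iff_odd]
      rintro ⟨k, rfl⟩
      exact hn ⟨k, two_mul k⟩
    simp [hν.integral_pow_odd]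

theorem tendsto_pow_div_risingFactorial {N : ℕ} (hN : 1 ≤ N) (m : ℕ) :
    Tendsto (fun θ : ℝ => θ ^ m / risingFactorial (θ * N) m) atTop (𝓝 ((1 / N : ℝ) ^ m)) := by
  have hN0 : (0 : ℝ) < N := by exact_mod_cast hN
  induction m with
  | zero => simp
  | succ m ih =>
    have h1 : Tendsto (fun θ : ℝ => θ / (θ * N + m)) atTop (𝓝 (1 / N)) := by
      have h2 : Tendsto (fun θ : ℝ => 1 / (N + m / θ)) atTop (𝓝 (1 / (N + 0))) :=
        tendsto_const_nhds.div (tendsto_const_nhds.add (tendsto_const_nhds.div_atTop tendsto_id))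
          (by simpa using hN0.ne')
      rw [add_zero] at h2
      refine h2.congr' ?_
      filter_upwards [eventually_gt_atTop 0] with θ hθ
      field_simp
    rw [pow_succ]
    refine (ih.mul h1).congr fun θ => ?_
    rw [risingFactorial_succ, pow_succ, div_mul_div_comm]

/-- The characteristic functions of rescaled Gegenbauer laws converge to a Gaussian one. -/
theorem tendsto_charFun_of_isGegenbauerLaw {N : ℕ} (hN : 1 ≤ N) {ν : ℝ → Measure ℝ}
    (hν : ∀ᶠ θ in atTop, IsGegenbauerLaw (θ * N) (ν θ)) (u : ℝ) :
    Tendsto (fun θ => charFun (ν θ) (√θ * u)) atTop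
      (𝓝 (Complex.exp (-(u ^ 2 / (4 * N)) : ℝ))) := by
  have hN0 : (0 : ℝ) < N := by exact_mod_cast hN
  have hlim : Tendsto (fun θ : ℝ => ∑' m : ℕ, (-(u ^ 2 / 4)) ^ m / m.factorial *
      (θ ^ m / risingFactorial (θ * N) m)) atTop
      (𝓝 (∑' m : ℕ, (-(u ^ 2 / 4)) ^ m / m.factorial * (1 / N : ℝ) ^ m)) := by
    -- The bound is uniform in θ because (θN)^m ≤ (θN)ₘ.
    refine tendsto_tsum_of_dominated_convergence
      (bound := fun m : ℕ => (u ^ 2 / 4 * (1 / N)) ^ m / m.factorial)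
      (Real.summable_pow_div_factorial _)
      (fun m => (tendsto_pow_div_risingFactorial hN m).const_mul _) ?_
    filter_upwards [eventually_gt_atTop 0] with θ hθ m
    have hp := risingFactorial_pos (mul_pos hθ hN0) m
    have hle : θ ^ m / risingFactorial (θ * N) m ≤ (1 / N) ^ m := by
      rw [div_le_iff₀ hp]
      calc θ ^ m = (1 / N) ^ m * (θ * N) ^ m := by rw [← mul_pow]; congr 1; field_simp
        _ ≤ _ := by gcongr; exact pow_le_risingFactorial (mul_pos hθ hN0) m
    rw [norm_mul, norm_div, norm_pow, norm_neg, Real.norm_of_nonneg (by positivity : 0 ≤ u ^ 2 / 4),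
      Real.norm_natCast, Real.norm_of_nonneg (by positivity), mul_pow, mul_div_right_comm]
    gcongr
  have hexp : ∑' m : ℕ, (-(u ^ 2 / 4)) ^ m / m.factorial * (1 / N : ℝ) ^ m =
      Real.exp (-(u ^ 2 / (4 * N))) := by
    rw [Real.exp_eq_exp_ℝ, NormedSpace.exp_eq_tsum_div]
    refine tsum_congr fun m => ?_
    rw [div_mul_eq_mul_div, ← mul_pow]
    congr 2
    field_simp
  rw [hexp] at hlim
  rw [← Complex.ofReal_exp]
  refine ((Complex.continuous_ofReal.tendsto _).comp hlim).congr' ?_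
  filter_upwards [hν, eventually_gt_atTop 0] with θ hθ h0
  rw [← (hθ.hasSum_charFun (√θ * u)).tsum_eq, Function.comp_apply, Complex.ofReal_tsum]
  refine tsum_congr fun m => ?_
  rw [mul_pow, Real.sq_sqrt h0.le, show -(θ * u ^ 2 / 4) = -(u ^ 2 / 4) * θ by ring, mul_pow]
  congr 1
  ring

end CentralLimit

/-! ### The main theorem -/

theorem theorem3p4 (N : ℕ) (hN : 1 ≤ N) (a b : ℝ) (ha : 0 ≤ a) (hb : 0 ≤ b) :
    (∀ θ : ℝ, 1 / 2 ≤ θ * N → ∃! μ : Measure ℝ, IsRectSumLaw N θ a b μ) ∧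
    ∀ {Ω : ℝ → Type*} [∀ θ, MeasurableSpace (Ω θ)] (P : ∀ θ, Measure (Ω θ))
      [∀ θ, IsProbabilityMeasure (P θ)] (c : ∀ θ, Ω θ → ℝ)
      (_ : ∀ θ, AEMeasurable (c θ) (P θ))
      (_ : ∀ᶠ θ in atTop, IsRectSum N θ a b (c θ) (P θ))
      {Ω' : Type*} [MeasurableSpace Ω'] (Q : Measure Ω') [IsProbabilityMeasure Q] (Z : Ω' → ℝ)
      (_ : HasLaw Z (gaussianReal 0 (2 / N * a ^ 2 * b ^ 2).toNNReal) Q),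
      TendstoInDistribution (fun θ ω => √θ * (c θ ω ^ 2 - (a ^ 2 + b ^ 2))) atTop Z P Q := by
  refine ⟨fun θ h => existsUnique_isRectSumLaw h ha hb, ?_⟩
  intro Ω _ P _ c hc hsum Ω' _ Q _ Z hZ
  have hN0 : (0 : ℝ) < N := by exact_mod_cast hN
  have hlarge : ∀ᶠ θ : ℝ in atTop, 1 / 2 ≤ θ * N :=
    (tendsto_id.atTop_mul_const hN0).eventually_ge_atTop _
  -- The measure 0 is a dummy value for small θ, where no Gegenbauer law is needed.
  have hex : ∀ θ : ℝ, ∃ ν : Measure ℝ, 1 / 2 ≤ θ * N → IsGegenbauerLaw (θ * N) ν := fun θ => by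
    by_cases h : 1 / 2 ≤ θ * N
    · obtain ⟨ν, hν⟩ := exists_isGegenbauerLaw h
      exact ⟨ν, fun _ => hν⟩
    · exact ⟨0, fun h' => absurd h' h⟩
  choose ν hν using hex
  have hmeas : ∀ θ, AEMeasurable (fun ω => √θ * (c θ ω ^ 2 - (a ^ 2 + b ^ 2))) (P θ) :=
    fun θ => by have := hc θ; fun_prop
  refine ⟨hmeas, hZ.aemeasurable, ?_⟩
  have hchar (t : ℝ) : Tendsto
      (fun θ => charFun ((P θ).map fun ω => √θ * (c θ ω ^ 2 - (a ^ 2 + b ^ 2))) t) atTop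
      (𝓝 (charFun (Q.map Z) t)) := by
    -- The fluctuation is √θ · 2abX, so its transform at t is that of X at √θ · 2abt.
    have h1 := tendsto_charFun_of_isGegenbauerLaw hN (ν := ν) (hlarge.mono hν) (2 * a * b * t)
    have h2 : charFun (Q.map Z) t =
        Complex.exp (-((2 * a * b * t) ^ 2 / (4 * N)) : ℝ) := by
      rw [hZ.map_eq, charFun_gaussianReal, Real.coe_toNNReal _ (by positivity)]
      congr 1
      push_cast
      field_simp
      ring
    rw [h2]
    refine h1.congr' ?_
    filter_upwards [hlarge, hsum] with θ hθ hs
    have h0 : 0 < θ * N := by linarith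
    have hmap := hs.2.map_fluctuation h0 ha hb (hν θ hθ) (√θ)
    rw [AEMeasurable.map_map_of_aemeasurable (by fun_prop) (hc θ)] at hmap
    have hcomp : (fun ω => √θ * (c θ ω ^ 2 - (a ^ 2 + b ^ 2))) =
      (fun x : ℝ => √θ * (x ^ 2 - (a ^ 2 + b ^ 2))) ∘ c θ := rfl
    rw [hcomp, hmap, charFun_map_mul]
    congr 1
    ring
  -- Restricting to sequences θ → ∞ makes Lévy's continuity theorem applicable.
  refine tendsto_of_seq_tendsto fun u hu => ?_
  exact ProbabilityMeasure.tendsto_iff_tendsto_charFun.2 fun t => (hchar t).comp hu
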